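/- Identify the algebra $\mathbb H_{\mathbb C}=\mathbb C\otimes_{\mathbb R}\mathbb H$ of complexified quaternions with the algebra of complex $2\times 2$ matrices $Z=\begin{pmatrix} z_{11}&z_{12}\\ z_{21}&z_{22}\end{pmatrix}$, the real quaternions $\mathbb H\subset\mathbb H_{\mathbb C}$ being the real span of $$e_0=1,\quad e_1=\begin{pmatrix}0&-i\\-i&0\end{pmatrix},\quad e_2=\begin{pmatrix}0&-1\\1&0\end{pmatrix},\quad e_3=\begin{pmatrix}-i&0\\0&i\end{pmatrix}.$$ Put $N(Z)=\det Z$, so that $N(x^0e_0+x^1e_1+x^2e_2+x^3e_3)=(x^0)^2+(x^1)^2+(x^2)^2+(x^3)^2$ on $\mathbb H$, and let $dZ^4=dz_{11}\wedge dz_{12}\wedge dz_{21}\wedge dz_{22}$. For $R>0$ let $U(2)_R=\{RZ\,;\ Z\in U(2)\}$, oriented by translating the orientation of the tangent space of $U(2)$ at $1$ (the skew-Hermitian matrices) in which $(-ie_0,e_1,e_2,e_3)$ is a positively oriented basis; that is, $(-iZe_0,Ze_1,Ze_2,Ze_3)$ is a positively oriented basis of the tangent space of $U(2)_R$ at $Z$.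 Then for every polynomial $F\in\mathbb C[z_{11},z_{12},z_{21},z_{22}]$ (with no differential condition imposed), every $R>0$ and every $W\in\mathbb H$ with $N(W)<R^2$, the $4$-form $\frac{F(Z)}{N(Z-W)^2}\,dZ^4$ is integrable over $U(2)_R$ and $$F(W)=\frac{i}{8\pi^3}\int_{Z\in U(2)_R}\frac{F(Z)}{N(Z-W)^2}\,dZ^4 .$$ -/

import Mathlib

open MeasureTheory Matrix
open scoped Quaternion

section Integration

variable {E : Type*} [NormedAddCommGroup E] [NormedSpace ℝ E]

/-- Let `S ⊆ E` be a `d`-dimensional submanifold whose orientation is given by a frame field `τ`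
(so `τ p` is a positively oriented basis of the tangent space of `S` at `p`).
`φ : D → S` is a positively oriented parametrization of `S` up to a null set: `D ⊆ ℝ^d` is open,
`φ` is `C¹` and injective on `D`, at every point of `D` the partial derivatives of `φ` arise
from the frame by a matrix of positive determinant, and the part of `S` that is not covered has
`d`-dimensional Hausdorff measure zero. -/
structure IsPositiveParametrization {d : ℕ} (S : Set E) (τ : E → Fin d → E)
    (D : Set (Fin d → ℝ)) (φ : (Fin d → ℝ) → E) : Prop where
  isOpen : IsOpen D
  contDiffOn : ContDiffOn ℝ 1 φ D
  injOn : Set.InjOn φ D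
  mapsTo : Set.MapsTo φ D S
  positive : ∀ y ∈ D, ∃ A : Matrix (Fin d) (Fin d) ℝ, 0 < A.det ∧
    ∀ j, fderiv ℝ φ y (Pi.single j 1) = ∑ i, A i j • τ (φ y) i
  null_compl : @Measure.hausdorffMeasure E _ (borel E) (@BorelSpace.mk E _ (borel E) rfl) (d : ℝ) (S \ φ '' D) = 0

/-- The coefficient of the pullback `φ^* ω` of a complex-valued `d`-form `ω`:
`φ^* ω = (pullbackCoeff ω φ) dy₁ ∧ ⋯ ∧ dy_d`. -/
noncomputable def pullbackCoeff {d : ℕ} (ω : E → E [⋀^Fin d]→ₗ[ℝ] ℂ) (φ : (Fin d → ℝ) → E)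
    (y : Fin d → ℝ) : ℂ :=
  ω (φ y) fun j => fderiv ℝ φ y (Pi.single j 1)

/-- The `d`-form `ω` is integrable over the submanifold `S` oriented by the frame field `τ`, with
`∫_S ω = I`: the integral is `∫_D φ^* ω` for a positively oriented parametrization `φ : D → S` up
to a null set (by the change of variables formula the value does not depend on `φ`). -/
def HasFormIntegral {d : ℕ} (S : Set E) (τ : E → Fin d → E) (ω : E → E [⋀^Fin d]→ₗ[ℝ] ℂ)
    (I : ℂ) : Prop :=
  ∃ (D : Set (Fin d → ℝ)) (φ : (Fin d → ℝ) → E), IsPositiveParametrization S τ D φ ∧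
    IntegrableOn (pullbackCoeff ω φ) D ∧ ∫ y in D, pullbackCoeff ω φ y = I

end Integration

/-- The complexified quaternions, realized as the complex `2 × 2` matrices. -/
abbrev HC : Type := Matrix (Fin 2) (Fin 2) ℂ

/- A norm on the finite-dimensional space `HC`; only its topology, the notion of `C¹` map and the
null sets of the Hausdorff measure are used, and these are the same for all norms. -/
attribute [local instance] Matrix.normedAddCommGroup Matrix.normedSpace

namespace HC

/-- `ẽ₀ = -i e₀, e₁, e₂, e₃`: the positively oriented basis of the space of skew-Hermitian
matrices, that is, of the tangent space of `U(2)` at `1`. -/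
noncomputable def basisM : Fin 4 → HC :=
  ![!![-Complex.I, 0; 0, -Complex.I], !![0, -Complex.I; -Complex.I, 0],
    !![0, -1; 1, 0], !![-Complex.I, 0; 0, Complex.I]]

/-- The real quaternions inside `HC`: `x⁰ + x¹ e₁ + x² e₂ + x³ e₃`. -/
noncomputable def ofQuaternion (X : ℍ[ℝ]) : HC :=
  (X.re : ℂ) • (1 : HC) + (X.imI : ℂ) • basisM 1 + (X.imJ : ℂ) • basisM 2
    + (X.imK : ℂ) • basisM 3

/-- The quadratic form `N` on `HC`. -/
noncomputable def N (Z : HC) : ℂ := Z.det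

/-- `N` on `HC` extends `N(X) = X X⁺` on the real quaternions. -/
theorem N_ofQuaternion (X : ℍ[ℝ]) : N (ofQuaternion X) = (Quaternion.normSq X : ℝ) := by
  simp only [N, ofQuaternion, basisM, Matrix.det_fin_two, Quaternion.normSq_def']
  simp
  ring_nf
  simp

/-- `U(2)_R = {R Z ; Z ∈ U(2)}`. -/
def U2 (R : ℝ) : Set HC := (fun Z : HC => R • Z) '' (Matrix.unitaryGroup (Fin 2) ℂ : Set HC)

/-- The orientation of `U(2)_R`: at `Z` it is given by the left translates
`Z ẽ₀, Z e₁, Z e₂, Z e₃` of the positively oriented basis of the tangent space of `U(2)` at `1`. -/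
noncomputable def frame (Z : HC) : Fin 4 → HC := fun i => Z * basisM i

/-- The coordinates `(z₁₁, z₁₂, z₂₁, z₂₂)`. -/
def coords : HC →ₗ[ℝ] (Fin 4 → ℂ) where
  toFun Z := ![Z 0 0, Z 0 1, Z 1 0, Z 1 1]
  map_add' Z Z' := by ext i; fin_cases i <;> rfl
  map_smul' c Z := by ext i; fin_cases i <;> rfl

/-- `dZ⁴ = dz₁₁ ∧ dz₁₂ ∧ dz₂₁ ∧ dz₂₂`, that is,
`dZ⁴(V₁, V₂, V₃, V₄) = det (coordinate j of V_i)`. -/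
noncomputable def dZ4 : HC [⋀^Fin 4]→ₗ[ℝ] ℂ where
  toMultilinearMap :=
    ((Matrix.detRowAlternating (n := Fin 4) (R := ℂ)).toMultilinearMap.restrictScalars ℝ).compLinearMap
      fun _ => coords
  map_eq_zero_of_eq' V i j hV hij := by
    refine Matrix.det_zero_of_row_eq (M := fun k => coords (V k)) hij ?_
    simp only [hV]

theorem dZ4_apply (V : Fin 4 → HC) :
    dZ4 V = Matrix.det (Matrix.of fun i => coords (V i)) := rfl

/-- The value of a polynomial in the matrix entries `z_ij` at `Z`. -/
noncomputable def evalPoly (F : MvPolynomial (Fin 2 × Fin 2) ℂ) (Z : HC) : ℂ :=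
  MvPolynomial.eval (fun p => Z p.1 p.2) F

end HC

/-! A real quaternion `W` satisfies `W Wᴴ = N(W)`, so `N(W) < R²` allows us to write `W = ρ M` with
`M = R U` in `U(2)_R` and `|ρ| < 1`. The substitution `Z = M (Y + ρ)(1 + ρ Y)⁻¹` maps `U(2)`
bijectively onto `U(2)_R` and sends `Y = 0` to `W`.

Under it, `dZ⁴` acquires the factor `det(M)² (1 - ρ²)⁴ det(1 + ρY)⁻⁴` (`dZ4_mul_left`,
`dZ4_mul_right`, `fderiv_mobius`), while `N(Z - W) = det M (1 - ρ²)² det Y / det(1 + ρY)`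
(`mobius_sub`). The form therefore becomes `G(Y) det(Y)⁻² dY⁴`, where `G(Y) = F(Z) det(1 + ρY)⁻²`
(`pullbackCoeff_movedPolar`).

In polar coordinates `det(Y)⁻² dY⁴ = -2i sin y₃ cos y₃ dy`, and `y₀` is the scalar phase in `Y =
e^{i y₀} Q`. Since `z ↦ G(zQ)` is holomorphic near the closed unit disc, its mean over the phase is
`G(0) = F(W)`; harmonicity or any other differential condition on `F` plays no role. The remaining
angles contribute only a constant, giving `-8iπ³ F(W)`.

That this is a legitimate parametrization rests on `exists_frame_matrix_movedPolar` (orientation),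
`movedPolar_injOn`, and `hausdorffMeasure_compl_movedPolar` (the uncovered part is null). -/

namespace HC

/-! ### The form `dZ⁴` and matrix multiplication -/

theorem dZ4_mul_left (M : HC) (V : Fin 4 → HC) :
    dZ4 (fun j => M * V j) = M.det ^ 2 * dZ4 V := by
  rw [dZ4_apply, dZ4_apply]
  -- `M` acts separately on the two columns of `V`, so in the four coordinates it is `M ⊗ 1`, of
  -- determinant `det(M)²`.
  have h : (Matrix.of fun i => coords (M * V i)) = (Matrix.of fun i => coords (V i)) *
      !![M 0 0, 0, M 1 0, 0; 0, M 0 0, 0, M 1 0; M 0 1, 0, M 1 1, 0; 0, M 0 1, 0, M 1 1] := by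
    ext i j
    fin_cases j <;>
      simp [coords, Matrix.mul_apply, Fin.sum_univ_succ] <;> ring
  rw [h, Matrix.det_mul, mul_comm]
  congr 1
  simp [Matrix.det_succ_row_zero, Fin.sum_univ_succ, Fin.succAbove]
  ring

theorem dZ4_mul_right (M : HC) (V : Fin 4 → HC) :
    dZ4 (fun j => V j * M) = M.det ^ 2 * dZ4 V := by
  rw [dZ4_apply, dZ4_apply]
  have h : (Matrix.of fun i => coords (V i * M)) = (Matrix.of fun i => coords (V i)) *
      !![M 0 0, M 0 1, 0, 0; M 1 0, M 1 1, 0, 0; 0, 0, M 0 0, M 0 1; 0, 0, M 1 0, M 1 1] := by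
    ext i j
    fin_cases j <;>
      simp [coords, Matrix.mul_apply, Fin.sum_univ_succ]
  rw [h, Matrix.det_mul, mul_comm]
  congr 1
  simp [Matrix.det_succ_row_zero, Fin.sum_univ_succ, Fin.succAbove]
  ring

theorem dZ4_basisM : dZ4 basisM = -4 * Complex.I := by
  rw [dZ4_apply]
  simp [Matrix.det_succ_row_zero, Fin.sum_univ_succ, Fin.succAbove, coords, basisM]
  ring_nf

theorem dZ4_sum_smul (A : Matrix (Fin 4) (Fin 4) ℝ) (e : Fin 4 → HC) :
    dZ4 (fun j => ∑ i, A i j • e i) = (A.det : ℂ) * dZ4 e := by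
  rw [dZ4_apply, dZ4_apply]
  have h : (Matrix.of fun j => coords (∑ i, A i j • e i)) =
      (A.map (Complex.ofRealHom : ℝ →+* ℂ))ᵀ * (Matrix.of fun i => coords (e i)) := by
    ext j k
    simp [Matrix.mul_apply, map_sum]
  rw [h, Matrix.det_mul, Matrix.det_transpose]
  congr 1
  exact (RingHom.map_det Complex.ofRealHom A).symm

/-! ### Skew-Hermitian matrices -/

theorem exists_sum_smul_basisM {X : HC} (hX : Xᴴ = -X) :
    ∃ a : Fin 4 → ℝ, X = ∑ i, a i • basisM i := by
  have h00 := congrFun (congrFun hX 0) 0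
  have h01 := congrFun (congrFun hX 1) 0
  have h11 := congrFun (congrFun hX 1) 1
  simp [Matrix.conjTranspose_apply, Complex.ext_iff] at h00 h01 h11
  refine ⟨![-((X 0 0).im + (X 1 1).im) / 2, -(X 0 1).im, -(X 0 1).re,
    ((X 1 1).im - (X 0 0).im) / 2], ?_⟩
  ext i j
  fin_cases i <;> fin_cases j <;>
    simp [Fin.sum_univ_succ, basisM, Complex.ext_iff] <;> (try constructor) <;> linarith

/-- Along a submanifold of `{Z | Z Zᴴ = c}` the matrix expressing the partial derivatives in
terms of the left-invariant frame is real, and its determinant is detected by `dZ⁴`. -/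
theorem exists_frame_matrix {Z : HC} (hZ : IsUnit Z.det) {V : Fin 4 → HC}
    (hV : ∀ j, (Z⁻¹ * V j)ᴴ = -(Z⁻¹ * V j)) :
    ∃ A : Matrix (Fin 4) (Fin 4) ℝ, (∀ j, V j = ∑ i, A i j • frame Z i) ∧
      dZ4 V = (A.det : ℂ) * (Z.det ^ 2 * (-4 * Complex.I)) := by
  choose a ha using fun j => exists_sum_smul_basisM (hV j)
  have h : ∀ j, V j = ∑ i, (Matrix.of fun i j => a j i) i j • frame Z i := by
    intro j
    have := congrArg (Z * ·) (ha j)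
    simpa [Matrix.mul_nonsing_inv_cancel_left Z _ hZ, Matrix.mul_sum, frame] using this
  refine ⟨Matrix.of fun i j => a j i, h, ?_⟩
  rw [← dZ4_basisM, ← dZ4_mul_left, ← dZ4_sum_smul]
  congr 1
  exact funext h

/-! ### The Cayley-type transformations of the unitary group -/

open scoped ComplexOrder in
-- A kernel vector satisfies `v = -a Q v`; since `Q` is an isometry this forces `|a| = 1`. Complex
-- `a` is needed for `a = ρ z` with `z` in the closed unit disc.
theorem det_one_add_smul_ne_zero {Q : HC} (hQ : Q ∈ Matrix.unitaryGroup (Fin 2) ℂ) {a : ℂ}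
    (ha : ‖a‖ < 1) : (1 + a • Q).det ≠ 0 := by
  intro h
  obtain ⟨v, hv, hPv⟩ := Matrix.exists_mulVec_eq_zero_iff.2 h
  have hv' : v = -(a • (Q *ᵥ v)) := by
    rw [Matrix.add_mulVec, Matrix.one_mulVec, Matrix.smul_mulVec] at hPv
    exact eq_neg_of_add_eq_zero_left hPv
  have hQ' : star Q * Q = 1 := Matrix.mem_unitaryGroup_iff'.1 hQ
  have hiso : star (Q *ᵥ v) ⬝ᵥ (Q *ᵥ v) = star v ⬝ᵥ v := by
    rw [Matrix.star_mulVec, ← Matrix.dotProduct_mulVec, Matrix.mulVec_mulVec,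
      ← Matrix.star_eq_conjTranspose, hQ', Matrix.one_mulVec]
  have hnorm : star v ⬝ᵥ v = (star a * a) * (star v ⬝ᵥ v) := by
    conv_lhs => rw [hv']
    rw [star_neg, star_smul, neg_dotProduct_neg, smul_dotProduct, dotProduct_smul, hiso]
    simp [mul_assoc]
  have hne : star v ⬝ᵥ v ≠ 0 := fun h0 => hv (dotProduct_star_self_eq_zero.1 h0)
  have h1 : star a * a = 1 := by
    have : (star a * a) * (star v ⬝ᵥ v) = 1 * (star v ⬝ᵥ v) := by rw [one_mul]; exact hnorm.symm
    exact mul_right_cancel₀ hne this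
  have h2 : ‖a‖ * ‖a‖ = 1 := by
    have := congrArg norm h1
    simpa using this
  nlinarith [norm_nonneg a]

/-- The map `Z ↦ (Z + ρ)(1 + ρ Z)⁻¹`; for `|ρ| < 1` it permutes the unitary matrices. -/
noncomputable def mobius (ρ : ℝ) (Z : HC) : HC :=
  (Z + (ρ : ℂ) • (1 : HC)) * (1 + (ρ : ℂ) • Z)⁻¹

theorem mobius_mul {ρ : ℝ} {Z : HC} (h : (1 + (ρ : ℂ) • Z).det ≠ 0) :
    mobius ρ Z * (1 + (ρ : ℂ) • Z) = Z + (ρ : ℂ) • (1 : HC) := by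
  rw [mobius, Matrix.nonsing_inv_mul_cancel_right _ _ h.isUnit]

/-- Turns the difference in the kernel `N(Z - W)` into a product, whose determinant factors. -/
theorem mobius_sub {ρ : ℝ} {Z : HC} (h : (1 + (ρ : ℂ) • Z).det ≠ 0) :
    mobius ρ Z - (ρ : ℂ) • (1 : HC) = (1 - (ρ : ℂ) ^ 2) • (Z * (1 + (ρ : ℂ) • Z)⁻¹) := by
  have h1 : (ρ : ℂ) • (1 : HC) =
      ((ρ : ℂ) • (1 + (ρ : ℂ) • Z)) * (1 + (ρ : ℂ) • Z)⁻¹ := by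
    rw [smul_mul_assoc, Matrix.mul_nonsing_inv _ h.isUnit]
  rw [h1, mobius, ← sub_mul, ← smul_mul_assoc]
  congr 1
  module

theorem one_sub_smul_mobius {ρ : ℝ} {Z : HC} (h : (1 + (ρ : ℂ) • Z).det ≠ 0) :
    1 - (ρ : ℂ) • mobius ρ Z = (1 - (ρ : ℂ) ^ 2) • (1 + (ρ : ℂ) • Z)⁻¹ := by
  have h1 : (1 : HC) = (1 + (ρ : ℂ) • Z) * (1 + (ρ : ℂ) • Z)⁻¹ := by
    rw [Matrix.mul_nonsing_inv _ h.isUnit]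
  nth_rewrite 1 [h1]
  rw [mobius, ← smul_mul_assoc, ← sub_mul]
  have h2 : 1 + (ρ : ℂ) • Z - (ρ : ℂ) • (Z + (ρ : ℂ) • (1 : HC)) =
      (1 - (ρ : ℂ) ^ 2) • (1 : HC) := by module
  rw [h2, smul_mul_assoc, one_mul]

theorem one_sub_sq_ne_zero {ρ : ℝ} (hρ : |ρ| < 1) : (1 - (ρ : ℂ) ^ 2) ≠ 0 := by
  have : (1 - ρ ^ 2) ≠ 0 := by nlinarith [sq_abs ρ, abs_nonneg ρ]
  exact_mod_cast this

/-- Numerator and denominator are given by `mobius_sub` and `one_sub_smul_mobius`, and share the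
factor `(1 - ρ²)(1 + ρZ)⁻¹`. -/
theorem mobius_neg_mobius {ρ : ℝ} (hρ : |ρ| < 1) {Z : HC} (h : (1 + (ρ : ℂ) • Z).det ≠ 0) :
    mobius (-ρ) (mobius ρ Z) = Z := by
  have h1 := mobius_sub h
  have h2 := one_sub_smul_mobius h
  have e1 : mobius ρ Z + ((-ρ : ℝ) : ℂ) • (1 : HC) = mobius ρ Z - (ρ : ℂ) • (1 : HC) := by
    push_cast; module
  have e2 : 1 + ((-ρ : ℝ) : ℂ) • mobius ρ Z = 1 - (ρ : ℂ) • mobius ρ Z := by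
    push_cast; module
  rw [mobius, e1, e2, h1, h2]
  have hc := one_sub_sq_ne_zero hρ
  have hdet : ((1 - (ρ : ℂ) ^ 2) • (1 + (ρ : ℂ) • Z)⁻¹).det ≠ 0 := by
    rw [Matrix.det_smul, Matrix.det_nonsing_inv, Ring.inverse_eq_inv']
    exact mul_ne_zero (pow_ne_zero _ hc) (inv_ne_zero h)
  rw [← mul_smul_comm, Matrix.mul_nonsing_inv_cancel_right _ _ hdet.isUnit]

theorem det_one_add_ne_zero {Q : HC} (hQ : Q ∈ Matrix.unitaryGroup (Fin 2) ℂ) {ρ : ℝ}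
    (hρ : |ρ| < 1) : (1 + (ρ : ℂ) • Q).det ≠ 0 :=
  det_one_add_smul_ne_zero hQ (by simpa using hρ)

/-- On unitary matrices, the numerator of `mobius` is `Q` times the adjoint of the denominator. Both
the unitarity and the determinant of `mobius ρ Q` follow from this. -/
theorem add_smul_one_eq {Q : HC} (hQ : Q ∈ Matrix.unitaryGroup (Fin 2) ℂ) (ρ : ℝ) :
    Q + (ρ : ℂ) • (1 : HC) = Q * (1 + (ρ : ℂ) • Q)ᴴ := by
  have hQ' : Q * Qᴴ = 1 := Matrix.mem_unitaryGroup_iff.1 hQ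
  simp [mul_add, hQ']

theorem det_add_smul_one {Q : HC} (hQ : Q ∈ Matrix.unitaryGroup (Fin 2) ℂ) (ρ : ℝ) :
    (Q + (ρ : ℂ) • (1 : HC)).det = Q.det * star (1 + (ρ : ℂ) • Q).det := by
  rw [add_smul_one_eq hQ, Matrix.det_mul, Matrix.det_conjTranspose]

theorem mobius_mem_unitaryGroup {Q : HC} (hQ : Q ∈ Matrix.unitaryGroup (Fin 2) ℂ) {ρ : ℝ}
    (hρ : |ρ| < 1) : mobius ρ Q ∈ Matrix.unitaryGroup (Fin 2) ℂ := by
  have hdet := det_one_add_ne_zero hQ hρ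
  have h1 : Q * Qᴴ = 1 := Matrix.mem_unitaryGroup_iff.1 hQ
  have h2 : Qᴴ * Q = 1 := Matrix.mem_unitaryGroup_iff'.1 hQ
  rw [Matrix.mem_unitaryGroup_iff', Matrix.star_eq_conjTranspose, mobius, add_smul_one_eq hQ]
  set P : HC := 1 + (ρ : ℂ) • Q with hP
  -- `P` is a polynomial in the normal matrix `Q`, hence normal.
  have hcomm : P * Pᴴ = Pᴴ * P := by
    simp [hP, mul_add, add_mul, h1, h2]
    abel
  have hinv : P * P⁻¹ = 1 := Matrix.mul_nonsing_inv _ hdet.isUnit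
  calc (Q * Pᴴ * P⁻¹)ᴴ * (Q * Pᴴ * P⁻¹) = (P⁻¹)ᴴ * (P * (Qᴴ * Q) * Pᴴ) * P⁻¹ := by
        simp only [Matrix.conjTranspose_mul, Matrix.conjTranspose_conjTranspose, Matrix.mul_assoc]
    _ = (P * P⁻¹)ᴴ * (P * P⁻¹) := by
        rw [h2, mul_one, hcomm, Matrix.conjTranspose_mul]
        simp only [Matrix.mul_assoc]
    _ = 1 := by rw [hinv]; simp

theorem det_mobius {Q : HC} (hQ : Q ∈ Matrix.unitaryGroup (Fin 2) ℂ) (ρ : ℝ) :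
    (mobius ρ Q).det = Q.det * star (1 + (ρ : ℂ) • Q).det * ((1 + (ρ : ℂ) • Q).det)⁻¹ := by
  rw [mobius, Matrix.det_mul, det_add_smul_one hQ, Matrix.det_nonsing_inv, Ring.inverse_eq_inv']

/-! ### Calculus of matrix-valued maps -/

section Calculus

variable {E : Type*} [NormedAddCommGroup E] [NormedSpace ℝ E]

theorem fderiv_matrix_mul {f g : E → HC} {x : E} (hf : DifferentiableAt ℝ f x)
    (hg : DifferentiableAt ℝ g x) (v : E) :
    fderiv ℝ (fun x => f x * g x) x v = f x * fderiv ℝ g x v + fderiv ℝ f x v * g x := by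
  have := (LinearMap.mul ℝ HC).toContinuousBilinearMap.fderiv_of_bilinear hf hg
  exact congrArg (fun L : E →L[ℝ] HC => L v) this

theorem fderiv_conjTranspose_mul {f g : E → HC} {x : E} (hf : DifferentiableAt ℝ f x)
    (hg : DifferentiableAt ℝ g x) (v : E) :
    fderiv ℝ (fun x => (f x)ᴴ * g x) x v =
      (f x)ᴴ * fderiv ℝ g x v + (fderiv ℝ f x v)ᴴ * g x := by
  let B : HC →ₗ[ℝ] HC →ₗ[ℝ] HC := LinearMap.mk₂ ℝ (fun A C => Aᴴ * C)
    (fun _ _ _ => by simp [add_mul]) (fun _ _ _ => by simp)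
    (fun _ _ _ => by simp [mul_add]) (fun _ _ _ => by simp)
  have := B.toContinuousBilinearMap.fderiv_of_bilinear hf hg
  exact congrArg (fun L : E →L[ℝ] HC => L v) this

/-- The logarithmic derivative of a map into a multiple of the unitary group is
skew-Hermitian. -/
theorem conjTranspose_inv_mul_fderiv {f : E → HC} {c : ℂ} (hc : c ≠ 0) (hc' : star c = c)
    (hf : Differentiable ℝ f) (h : ∀ x, (f x)ᴴ * f x = c • (1 : HC)) (x v : E) :
    ((f x)⁻¹ * fderiv ℝ f x v)ᴴ = -((f x)⁻¹ * fderiv ℝ f x v) := by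
  have hinv : (f x)⁻¹ = c⁻¹ • (f x)ᴴ := by
    refine Matrix.inv_eq_left_inv ?_
    rw [smul_mul_assoc, h, smul_smul, inv_mul_cancel₀ hc, one_smul]
  have h0 := fderiv_conjTranspose_mul (hf x) (hf x) v
  rw [funext h] at h0
  have h0 : (f x)ᴴ * fderiv ℝ f x v + (fderiv ℝ f x v)ᴴ * f x = 0 := by simpa using h0.symm
  rw [hinv, smul_mul_assoc, Matrix.conjTranspose_smul, Matrix.conjTranspose_mul,
    Matrix.conjTranspose_conjTranspose, star_inv₀, hc', ← smul_neg]
  congr 1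
  exact (neg_eq_of_add_eq_zero_right h0).symm

theorem contDiff_matrix_iff {f : E → HC} {n : WithTop ℕ∞} :
    ContDiff ℝ n f ↔ ∀ i j, ContDiff ℝ n fun x => f x i j := by
  constructor
  · intro h i j
    exact contDiff_pi.1 (contDiff_pi.1 h i) j
  · intro h
    exact contDiff_pi.2 fun i => contDiff_pi.2 fun j => h i j

theorem contDiff_mobius {f : E → HC} {n : WithTop ℕ∞} (hf : ContDiff ℝ n f) {ρ : ℝ}
    (h : ∀ x, (1 + (ρ : ℂ) • f x).det ≠ 0) : ContDiff ℝ n fun x => mobius ρ (f x) := by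
  have hf' := contDiff_matrix_iff.1 hf
  have hdet : ContDiff ℝ n fun x => ((1 + (ρ : ℂ) • f x).det)⁻¹ := by
    refine ContDiff.inv ?_ h
    simp only [Matrix.det_fin_two, Matrix.add_apply, Matrix.smul_apply, smul_eq_mul]
    have := hf' 0 0
    have := hf' 0 1
    have := hf' 1 0
    have := hf' 1 1
    fun_prop
  refine contDiff_matrix_iff.2 fun i j => ?_
  simp only [mobius, Matrix.inv_def, Ring.inverse_eq_inv', Matrix.adjugate_fin_two,
    Matrix.mul_apply, Fin.sum_univ_two, Matrix.add_apply, Matrix.smul_apply, smul_eq_mul]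
  have := hf' i 0
  have := hf' i 1
  have := hf' 0 0
  have := hf' 0 1
  have := hf' 1 0
  have := hf' 1 1
  fin_cases j <;> simp <;> fun_prop

/-- Differentiating `mobius_mul` avoids the derivative of a matrix inverse. The left-hand inverse
factor comes from `one_sub_smul_mobius`. -/
theorem fderiv_mobius {f : E → HC} (hf : ContDiff ℝ 1 f) {ρ : ℝ}
    (h : ∀ x, (1 + (ρ : ℂ) • f x).det ≠ 0) (x v : E) :
    fderiv ℝ (fun x => mobius ρ (f x)) x v = (1 - (ρ : ℂ) ^ 2) •
      ((1 + (ρ : ℂ) • f x)⁻¹ * fderiv ℝ f x v * (1 + (ρ : ℂ) • f x)⁻¹) := by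
  have hfd := hf.differentiable one_ne_zero x
  have hmd := (contDiff_mobius hf h).differentiable one_ne_zero x
  have hP : ∀ x, 1 + (ρ : ℂ) • f x = 1 + ρ • f x := fun x => by ext; simp
  have hPd : HasFDerivAt (fun x => 1 + (ρ : ℂ) • f x) (ρ • fderiv ℝ f x) x := by
    simp only [hP]
    exact (hfd.hasFDerivAt.const_smul ρ).const_add 1
  have hP' : fderiv ℝ (fun x => 1 + (ρ : ℂ) • f x) x v = (ρ : ℂ) • fderiv ℝ f x v :=
    (congrArg (fun L : E →L[ℝ] HC => L v) hPd.fderiv).trans (by ext; simp)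
  have hQ : fderiv ℝ (fun x => f x + (ρ : ℂ) • (1 : HC)) x v = fderiv ℝ f x v :=
    congrArg (fun L : E →L[ℝ] HC => L v) (hfd.hasFDerivAt.add_const _).fderiv
  have h1 := fderiv_matrix_mul hmd hPd.differentiableAt v
  rw [funext fun x => mobius_mul (h x), hP', hQ] at h1
  have h2 : fderiv ℝ (fun x => mobius ρ (f x)) x v * (1 + (ρ : ℂ) • f x) =
      (1 - (ρ : ℂ) • mobius ρ (f x)) * fderiv ℝ f x v := by
    rw [sub_mul, one_mul, smul_mul_assoc, ← mul_smul_comm]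
    exact eq_sub_of_add_eq' h1.symm
  rw [one_sub_smul_mobius (h x)] at h2
  have h3 := congrArg (· * (1 + (ρ : ℂ) • f x)⁻¹) h2
  simp only [Matrix.mul_nonsing_inv_cancel_right _ _ (h x).isUnit] at h3
  rw [h3, smul_mul_assoc, smul_mul_assoc]

end Calculus

/-! ### Polar coordinates on the unitary group -/

/-- The matrix `e^{-i y₀} Z(y)`, where `Z(y)` is the point of `U(2)` with coordinates `y`. -/
noncomputable def angularPart (y : Fin 4 → ℝ) : HC :=
  !![(Real.cos (y 3) : ℂ), (Real.sin (y 3) : ℂ) * Complex.exp (y 1 * Complex.I);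
    -((Real.sin (y 3) : ℂ) * Complex.exp (y 2 * Complex.I)),
    (Real.cos (y 3) : ℂ) * (Complex.exp (y 1 * Complex.I) * Complex.exp (y 2 * Complex.I))]

/-- Polar coordinates on `U(2)`. -/
noncomputable def polar (y : Fin 4 → ℝ) : HC := Complex.exp (y 0 * Complex.I) • angularPart y

theorem exp_mul_conj_exp (t : ℝ) : Complex.exp (t * Complex.I) *
    (starRingEnd ℂ) (Complex.exp (t * Complex.I)) = 1 := by
  rw [Complex.mul_conj, Complex.normSq_eq_norm_sq, Complex.norm_exp_ofReal_mul_I]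
  simp

theorem angularPart_mem_unitaryGroup (y : Fin 4 → ℝ) :
    angularPart y ∈ Matrix.unitaryGroup (Fin 2) ℂ := by
  rw [Matrix.mem_unitaryGroup_iff]
  have h1 := exp_mul_conj_exp (y 1)
  have h2 := exp_mul_conj_exp (y 2)
  have h3 : (Real.cos (y 3) : ℂ) ^ 2 + (Real.sin (y 3) : ℂ) ^ 2 = 1 := by
    exact_mod_cast Real.cos_sq_add_sin_sq (y 3)
  simp only [angularPart]
  generalize Complex.exp (y 1 * Complex.I) = a at *
  generalize Complex.exp (y 2 * Complex.I) = b at *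
  generalize Real.cos (y 3) = c at *
  generalize Real.sin (y 3) = s at *
  ext i j
  fin_cases i <;> fin_cases j <;> simp [Matrix.mul_apply, Fin.sum_univ_two, Matrix.star_apply]
  · linear_combination h3 + (s : ℂ) ^ 2 * h1
  · linear_combination (s * c * (starRingEnd ℂ) b) * h1
  · linear_combination (s * c * b) * h1
  · linear_combination h3 + ((s : ℂ) ^ 2 + (c : ℂ) ^ 2) * h2 +
      (c : ℂ) ^ 2 * b * (starRingEnd ℂ) b * h1

theorem polar_mem_unitaryGroup (y : Fin 4 → ℝ) : polar y ∈ Matrix.unitaryGroup (Fin 2) ℂ := by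
  have h := Matrix.mem_unitaryGroup_iff.1 (angularPart_mem_unitaryGroup y)
  rw [Matrix.mem_unitaryGroup_iff, polar, star_smul, smul_mul_smul_comm, h]
  have := exp_mul_conj_exp (y 0)
  simp only [Complex.star_def, this, one_smul]

theorem det_polar (y : Fin 4 → ℝ) : (polar y).det = Complex.exp (y 0 * Complex.I) ^ 2 *
    (Complex.exp (y 1 * Complex.I) * Complex.exp (y 2 * Complex.I)) := by
  have h3 : (Real.cos (y 3) : ℂ) ^ 2 + (Real.sin (y 3) : ℂ) ^ 2 = 1 := by
    exact_mod_cast Real.cos_sq_add_sin_sq (y 3)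
  rw [polar, Matrix.det_smul, angularPart, Matrix.det_fin_two_of, Fintype.card_fin]
  linear_combination (Complex.exp (y 0 * Complex.I) ^ 2 *
    (Complex.exp (y 1 * Complex.I) * Complex.exp (y 2 * Complex.I))) * h3

theorem contDiff_polar : ContDiff ℝ 1 polar := by
  have h0 : ∀ k : Fin 4, ContDiff ℝ 1 fun y : Fin 4 → ℝ => ((y k : ℝ) : ℂ) := fun k =>
    Complex.ofRealCLM.contDiff.comp (contDiff_apply ℝ ℝ k)
  have hE : ∀ k : Fin 4, ContDiff ℝ 1 fun y : Fin 4 → ℝ => Complex.exp (y k * Complex.I) :=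
    fun k => ((h0 k).mul contDiff_const).cexp
  have hC : ContDiff ℝ 1 fun y : Fin 4 → ℝ => (Real.cos (y 3) : ℂ) :=
    Complex.ofRealCLM.contDiff.comp (Real.contDiff_cos.comp (contDiff_apply ℝ ℝ 3))
  have hS : ContDiff ℝ 1 fun y : Fin 4 → ℝ => (Real.sin (y 3) : ℂ) :=
    Complex.ofRealCLM.contDiff.comp (Real.contDiff_sin.comp (contDiff_apply ℝ ℝ 3))
  refine contDiff_matrix_iff.2 fun i j => ?_
  fin_cases i <;> fin_cases j
  · exact (hE 0).mul hC
  · exact (hE 0).mul (hS.mul (hE 1))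
  · exact (hE 0).mul (hS.mul (hE 2)).neg
  · exact (hE 0).mul (hC.mul ((hE 1).mul (hE 2)))

theorem fderiv_polar (y v : Fin 4 → ℝ) : fderiv ℝ polar y v =
    Complex.exp (y 0 * Complex.I) • !![
      v 0 * Complex.I * Real.cos (y 3) - v 3 * Real.sin (y 3),
      ((v 0 + v 1) * Complex.I * Real.sin (y 3) + v 3 * Real.cos (y 3)) *
        Complex.exp (y 1 * Complex.I);
      -((v 0 + v 2) * Complex.I * Real.sin (y 3) + v 3 * Real.cos (y 3)) *
        Complex.exp (y 2 * Complex.I),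
      ((v 0 + v 1 + v 2) * Complex.I * Real.cos (y 3) - v 3 * Real.sin (y 3)) *
        (Complex.exp (y 1 * Complex.I) * Complex.exp (y 2 * Complex.I))] := by
  refine (contDiff_polar.differentiable one_ne_zero y).lineDeriv_eq_fderiv.symm.trans
    (HasLineDerivAt.lineDeriv ?_)
  have hl : ∀ k, HasDerivAt (fun s : ℝ => (y + s • v) k) (v k) 0 := by
    intro k
    simpa using ((hasDerivAt_id (0 : ℝ)).mul_const (v k)).const_add (y k)
  have hE : ∀ k, HasDerivAt (fun s : ℝ => Complex.exp (((y + s • v) k : ℝ) * Complex.I))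
      (Complex.exp (y k * Complex.I) * (v k * Complex.I)) 0 := by
    intro k
    simpa using ((hl k).ofReal_comp.mul_const Complex.I).cexp
  have hC : HasDerivAt (fun s : ℝ => (Real.cos ((y + s • v) 3) : ℂ))
      ((-Real.sin (y 3) * v 3 : ℝ) : ℂ) 0 := by
    simpa using (hl 3).cos.ofReal_comp
  have hS : HasDerivAt (fun s : ℝ => (Real.sin ((y + s • v) 3) : ℂ))
      ((Real.cos (y 3) * v 3 : ℝ) : ℂ) 0 := by
    simpa using (hl 3).sin.ofReal_comp
  refine hasDerivAt_pi.2 fun i => hasDerivAt_pi.2 fun j => ?_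
  fin_cases i <;> fin_cases j
  · refine ((hE 0).mul hC).congr_deriv ?_
    simp; ring
  · refine ((hE 0).mul (hS.mul (hE 1))).congr_deriv ?_
    simp; ring
  · refine ((hE 0).mul (hS.mul (hE 2)).neg).congr_deriv ?_
    simp; ring
  · refine ((hE 0).mul (hC.mul ((hE 1).mul (hE 2)))).congr_deriv ?_
    simp; ring

/-- The factor `det²` is the one that `dZ4_mul_left` gives for the left-invariant frame; it later
cancels against `N(Z - W)²`. -/
theorem dZ4_fderiv_polar (y : Fin 4 → ℝ) :
    dZ4 (fun j => fderiv ℝ polar y (Pi.single j 1)) =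
      -2 * Complex.I * (Real.sin (y 3) * Real.cos (y 3)) * (polar y).det ^ 2 := by
  have h3 : (Real.cos (y 3) : ℂ) ^ 2 + (Real.sin (y 3) : ℂ) ^ 2 = 1 := by
    exact_mod_cast Real.cos_sq_add_sin_sq (y 3)
  rw [det_polar, dZ4_apply]
  simp only [fderiv_polar]
  generalize Complex.exp (y 0 * Complex.I) = e
  generalize Complex.exp (y 1 * Complex.I) = a
  generalize Complex.exp (y 2 * Complex.I) = b
  generalize (Real.cos (y 3) : ℂ) = c at *
  generalize (Real.sin (y 3) : ℂ) = s at *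
  have hI := Complex.I_sq
  simp [Matrix.det_succ_row_zero, Fin.sum_univ_succ, Fin.succAbove, coords, Pi.single_apply]
  linear_combination (2 * e ^ 4 * Complex.I ^ 3 * c * s * a ^ 2 * b ^ 2) * h3 +
    (2 * e ^ 4 * Complex.I * c * s * a ^ 2 * b ^ 2) * hI

/-- The upper ends of the coordinate intervals of `polar`. -/
noncomputable def polarBound : Fin 4 → ℝ :=
  ![2 * Real.pi, 2 * Real.pi, 2 * Real.pi, Real.pi / 2]

/-- The open box on which `polar` is a coordinate system. -/
def polarBox : Set (Fin 4 → ℝ) := Set.univ.pi fun i => Set.Ioo 0 (polarBound i)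

theorem exp_mul_I_injOn :
    Set.InjOn (fun t : ℝ => Complex.exp (t * Complex.I)) (Set.Ioo 0 (2 * Real.pi)) := by
  intro s hs t ht h
  obtain ⟨n, hn⟩ := Complex.exp_eq_exp_iff_exists_int.1 h
  have h1 : s = t + n * (2 * Real.pi) := by
    have := congrArg Complex.im hn
    simpa using this
  have hpi := Real.pi_pos
  have h2 : (-1 : ℝ) < n := by
    by_contra! h'
    nlinarith [hs.1, hs.2, ht.1, ht.2]
  have h3 : (n : ℝ) < 1 := by
    by_contra! h'
    nlinarith [hs.1, hs.2, ht.1, ht.2]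
  have h4 : n = 0 := by
    have h2' : (-1 : ℤ) < n := by exact_mod_cast h2
    have h3' : n < (1 : ℤ) := by exact_mod_cast h3
    omega
  simpa [h4] using h1

/-- The modulus of `z₁₁` is `cos y₃`, which determines `y₃`. As `sin y₃` and `cos y₃` do not vanish,
the phases of `z₁₁`, `z₁₂`, `z₂₁` then determine `y₀`, `y₁`, `y₂` in turn. -/
theorem polar_injOn : Set.InjOn polar polarBox := by
  intro y hy z hz h
  have hmem : ∀ {w : Fin 4 → ℝ}, w ∈ polarBox → ∀ i, w i ∈ Set.Ioo 0 (polarBound i) :=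
    fun hw i => hw i (Set.mem_univ i)
  have hy3 : y 3 ∈ Set.Ioo 0 (Real.pi / 2) := hmem hy 3
  have hz3 : z 3 ∈ Set.Ioo 0 (Real.pi / 2) := hmem hz 3
  have hpi := Real.pi_pos
  have hcy : 0 < Real.cos (y 3) := Real.cos_pos_of_mem_Ioo ⟨by linarith [hy3.1], hy3.2⟩
  have hcz : 0 < Real.cos (z 3) := Real.cos_pos_of_mem_Ioo ⟨by linarith [hz3.1], hz3.2⟩
  have hsy : 0 < Real.sin (y 3) := Real.sin_pos_of_pos_of_lt_pi hy3.1 (by linarith [hy3.2])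
  have h00 := congrFun (congrFun h 0) 0
  have h01 := congrFun (congrFun h 0) 1
  have h10 := congrFun (congrFun h 1) 0
  simp only [polar, angularPart, Matrix.smul_apply, smul_eq_mul, Matrix.of_apply,
    Matrix.cons_val_zero, Matrix.cons_val_one, Matrix.cons_val', Matrix.cons_val_fin_one]
    at h00 h01 h10
  have hcos : Real.cos (y 3) = Real.cos (z 3) := by
    have := congrArg norm h00
    rwa [norm_mul, norm_mul, Complex.norm_exp_ofReal_mul_I, Complex.norm_exp_ofReal_mul_I,
      Complex.norm_real, Complex.norm_real, Real.norm_of_nonneg hcy.le,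
      Real.norm_of_nonneg hcz.le, one_mul, one_mul] at this
  have e3 : y 3 = z 3 := Real.injOn_cos ⟨hy3.1.le, by linarith [hy3.2]⟩
    ⟨hz3.1.le, by linarith [hz3.2]⟩ hcos
  have hcy' : (Real.cos (y 3) : ℂ) ≠ 0 := by exact_mod_cast hcy.ne'
  have hsy' : (Real.sin (y 3) : ℂ) ≠ 0 := by exact_mod_cast hsy.ne'
  rw [← e3] at h00 h01 h10
  have f0 := mul_right_cancel₀ hcy' h00
  have e0 : y 0 = z 0 := exp_mul_I_injOn (hmem hy 0) (hmem hz 0) f0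
  rw [← f0] at h01 h10
  have f1 := mul_left_cancel₀ hsy' (mul_left_cancel₀ (Complex.exp_ne_zero _) h01)
  have e1 : y 1 = z 1 := exp_mul_I_injOn (hmem hy 1) (hmem hz 1) f1
  have f2 := mul_left_cancel₀ hsy' (neg_injective (mul_left_cancel₀ (Complex.exp_ne_zero _) h10))
  have e2 : y 2 = z 2 := exp_mul_I_injOn (hmem hy 2) (hmem hz 2) f2
  ext i
  fin_cases i
  exacts [e0, e1, e2, e3]

theorem exists_angle (z : ℂ) :
    ∃ t ∈ Set.Icc 0 (2 * Real.pi), z = ‖z‖ * Complex.exp (t * Complex.I) := by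
  have hz := Complex.norm_mul_exp_arg_mul_I z
  have h1 := Complex.neg_pi_lt_arg z
  have h2 := Complex.arg_le_pi z
  rcases le_or_gt 0 z.arg with h | h
  · exact ⟨z.arg, ⟨h, by linarith⟩, hz.symm⟩
  · refine ⟨z.arg + 2 * Real.pi, ⟨by linarith, by linarith⟩, ?_⟩
    have : ((z.arg + 2 * Real.pi : ℝ) : ℂ) * Complex.I =
        z.arg * Complex.I + 2 * Real.pi * Complex.I := by push_cast; ring
    rw [this, Complex.exp_periodic, hz]

/-- Unitarity gives `|z₂₂| = |z₁₁|` and `|z₂₁| = |z₁₂|`. The angles are read off from `z₁₁`, `z₁₂`,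
`z₂₁`, and orthogonality of the columns then fixes `z₂₂`. -/
theorem exists_polar_eq {Z : HC} (hZ : Z ∈ Matrix.unitaryGroup (Fin 2) ℂ) :
    ∃ y : Fin 4 → ℝ, (∀ i, y i ∈ Set.Icc 0 (polarBound i)) ∧ polar y = Z := by
  have h1 : Z * star Z = 1 := Matrix.mem_unitaryGroup_iff.1 hZ
  have h2 : star Z * Z = 1 := Matrix.mem_unitaryGroup_iff'.1 hZ
  have r00 := congrFun (congrFun h1 0) 0
  have c00 := congrFun (congrFun h2 0) 0
  have c11 := congrFun (congrFun h2 1) 1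
  have c01 := congrFun (congrFun h2 0) 1
  simp only [Matrix.mul_apply, Fin.sum_univ_two, Matrix.star_apply, Complex.star_def,
    Complex.mul_conj, Complex.conj_mul', Matrix.one_apply_eq, Complex.normSq_eq_norm_sq]
    at r00 c00 c11
  simp [Matrix.mul_apply, Fin.sum_univ_two, Matrix.star_apply] at c01
  norm_cast at r00 c00 c11
  have hc0 := norm_nonneg (Z 0 0)
  have hs0 := norm_nonneg (Z 0 1)
  have hs0' := norm_nonneg (Z 1 0)
  have hc0' := norm_nonneg (Z 1 1)
  have hss : ‖Z 1 0‖ = ‖Z 0 1‖ := by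
    rw [← Real.sqrt_sq hs0', ← Real.sqrt_sq hs0]; congr 1; linarith
  have hcc : ‖Z 1 1‖ = ‖Z 0 0‖ := by
    rw [← Real.sqrt_sq hc0', ← Real.sqrt_sq hc0]; congr 1; linarith
  have hle : ‖Z 0 0‖ ≤ 1 := by nlinarith [sq_nonneg ‖Z 0 1‖]
  have hcos : Real.cos (Real.arccos ‖Z 0 0‖) = ‖Z 0 0‖ := Real.cos_arccos (by linarith) hle
  have hsin : Real.sin (Real.arccos ‖Z 0 0‖) = ‖Z 0 1‖ := by
    rw [Real.sin_arccos, ← Real.sqrt_sq hs0]; congr 1; linarith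
  have hθ : Real.arccos ‖Z 0 0‖ ∈ Set.Icc 0 (Real.pi / 2) :=
    ⟨Real.arccos_nonneg _, Real.arccos_le_pi_div_two.2 hc0⟩
  obtain ⟨t, ht, et⟩ := exists_angle (Z 0 0)
  have hne : Complex.exp (t * Complex.I) ≠ 0 := Complex.exp_ne_zero _
  have hn1 : ‖Complex.exp (t * Complex.I)‖ = 1 := Complex.norm_exp_ofReal_mul_I t
  have key : ∀ b ∈ Set.Icc 0 (2 * Real.pi), ∀ g ∈ Set.Icc 0 (2 * Real.pi),
      Z 0 1 = Complex.exp (t * Complex.I) * (‖Z 0 1‖ * Complex.exp (b * Complex.I)) →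
      Z 1 0 = Complex.exp (t * Complex.I) * -(‖Z 0 1‖ * Complex.exp (g * Complex.I)) →
      Z 1 1 = Complex.exp (t * Complex.I) *
        (‖Z 0 0‖ * (Complex.exp (b * Complex.I) * Complex.exp (g * Complex.I))) →
      ∃ y : Fin 4 → ℝ, (∀ i, y i ∈ Set.Icc 0 (polarBound i)) ∧ polar y = Z := by
    intro b hb g hg e01 e10 e11
    refine ⟨![t, b, g, Real.arccos ‖Z 0 0‖], ?_, ?_⟩
    · intro i
      fin_cases i
      exacts [ht, hb, hg, hθ]
    · have e00 : Z 0 0 = Complex.exp (t * Complex.I) * ‖Z 0 0‖ := by rw [mul_comm]; exact et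
      have : polar ![t, b, g, Real.arccos ‖Z 0 0‖] =
          !![Complex.exp (t * Complex.I) * ‖Z 0 0‖,
            Complex.exp (t * Complex.I) * (‖Z 0 1‖ * Complex.exp (b * Complex.I));
            Complex.exp (t * Complex.I) * -(‖Z 0 1‖ * Complex.exp (g * Complex.I)),
            Complex.exp (t * Complex.I) *
              (‖Z 0 0‖ * (Complex.exp (b * Complex.I) * Complex.exp (g * Complex.I)))] := by
        rw [polar, angularPart]
        simp only [Matrix.cons_val, hcos, hsin]
        simp
      rw [this, ← e00, ← e01, ← e10, ← e11]
      exact (Matrix.eta_fin_two Z).symm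
  have hpi := Real.pi_pos
  -- For diagonal `Z` the off-diagonal phases are undefined: only their product matters, so one
  -- angle is taken from `z₂₂` and the other is `0`.
  by_cases hs : ‖Z 0 1‖ = 0
  · have hc1 : ‖Z 0 0‖ = 1 := by
      rw [hs] at r00
      nlinarith
    obtain ⟨b, hb, eb⟩ := exists_angle (Z 1 1 / Complex.exp (t * Complex.I))
    rw [norm_div, hn1, hcc, hc1, div_eq_iff hne] at eb
    refine key b hb 0 ⟨le_rfl, by linarith⟩ ?_ ?_ ?_
    · rw [hs, norm_eq_zero.1 hs]
      simp
    · rw [hs] at hss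
      simpa [hs] using hss
    · rw [eb, hc1]
      simp [mul_comm]
  · obtain ⟨b, hb, eb⟩ := exists_angle (Z 0 1 / Complex.exp (t * Complex.I))
    obtain ⟨g, hg, eg⟩ := exists_angle (-Z 1 0 / Complex.exp (t * Complex.I))
    rw [norm_div, hn1, div_one, div_eq_iff hne, mul_comm] at eb
    rw [norm_div, hn1, div_one, div_eq_iff hne, norm_neg, hss] at eg
    have eg' : Z 1 0 = Complex.exp (t * Complex.I) * -(‖Z 0 1‖ * Complex.exp (g * Complex.I)) := by
      linear_combination -eg
    refine key b hb g hg eb eg' ?_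
    have hs' : (‖Z 0 1‖ : ℂ) ≠ 0 := by exact_mod_cast hs
    have ht := exp_mul_conj_exp t
    have hgc := exp_mul_conj_exp g
    -- Multiplying by these phases cancels their conjugates in the orthogonality relation of the
    -- columns.
    have c01' := congrArg (fun w => Complex.exp (t * Complex.I) * Complex.exp (g * Complex.I) * w) c01
    simp only [mul_zero] at c01'
    have x00 : (starRingEnd ℂ) (Z 0 0) = ‖Z 0 0‖ * (starRingEnd ℂ) (Complex.exp (t * Complex.I)) := by
      conv_lhs => rw [et]
      simp
    have x10 : (starRingEnd ℂ) (Z 1 0) = (starRingEnd ℂ) (Complex.exp (t * Complex.I)) *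
        -(‖Z 0 1‖ * (starRingEnd ℂ) (Complex.exp (g * Complex.I))) := by
      conv_lhs => rw [eg']
      simp
    rw [x00, x10] at c01'
    have e01 := eb
    generalize Z 1 1 = z11 at *
    generalize Z 0 1 = z01 at *
    generalize (‖Z 0 0‖ : ℂ) = c at *
    generalize (‖z01‖ : ℂ) = s at *
    generalize Complex.exp (t * Complex.I) = T at *
    generalize Complex.exp (b * Complex.I) = B at *
    generalize Complex.exp (g * Complex.I) = G at *
    generalize (starRingEnd ℂ) T = T' at *
    generalize (starRingEnd ℂ) G = G' at *
    refine mul_left_cancel₀ hs' ?_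
    linear_combination -c01' + (c * G * T * s * B - s * G * G' * z11) * ht - s * z11 * hgc + T * T' * c * G * e01

/-! ### The parametrization of `U(2)_R` adapted to a point of the ball -/

section Param

variable {R ρ : ℝ} {U : HC}

/-- The polar coordinates on `U(2)`, moved to `U(2)_R` by `Z ↦ M (Z + ρ)(1 + ρ Z)⁻¹`, where `M`
is a point of `U(2)_R`. -/
noncomputable def movedPolar (M : HC) (ρ : ℝ) (y : Fin 4 → ℝ) : HC := M * mobius ρ (polar y)

theorem det_one_add_polar_ne_zero (hρ : |ρ| < 1) (y : Fin 4 → ℝ) :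
    (1 + (ρ : ℂ) • polar y).det ≠ 0 :=
  det_one_add_ne_zero (polar_mem_unitaryGroup y) hρ

theorem contDiff_movedPolar (M : HC) (hρ : |ρ| < 1) : ContDiff ℝ 1 (movedPolar M ρ) := by
  have h := contDiff_matrix_iff.1 (contDiff_mobius contDiff_polar (det_one_add_polar_ne_zero hρ))
  refine contDiff_matrix_iff.2 fun i j => ?_
  simp only [movedPolar, Matrix.mul_apply, Fin.sum_univ_two]
  have := h 0 j
  have := h 1 j
  fun_prop

theorem fderiv_movedPolar (M : HC) (hρ : |ρ| < 1) (y v : Fin 4 → ℝ) :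
    fderiv ℝ (movedPolar M ρ) y v =
      ((1 - (ρ : ℂ) ^ 2) • (M * (1 + (ρ : ℂ) • polar y)⁻¹)) * fderiv ℝ polar y v *
        (1 + (ρ : ℂ) • polar y)⁻¹ := by
  have hd := det_one_add_polar_ne_zero hρ
  have h := fderiv_matrix_mul (differentiableAt_const M)
    ((contDiff_mobius contDiff_polar hd).differentiable one_ne_zero y) v
  rw [fderiv_mobius contDiff_polar hd] at h
  have h0 : fderiv ℝ (fun _ : Fin 4 → ℝ => M) y v = 0 :=
    congrArg (fun L : (Fin 4 → ℝ) →L[ℝ] HC => L v) (hasFDerivAt_const M y).fderiv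
  rw [h0, zero_mul, add_zero] at h
  refine h.trans ?_
  simp only [mul_smul_comm, smul_mul_assoc, Matrix.mul_assoc]

/-- Each one-sided factor contributes its squared determinant. A scalar has determinant equal to its
square on `2 × 2` matrices, whence the fourth power of `1 - ρ²`. -/
theorem dZ4_fderiv_movedPolar (M : HC) (hρ : |ρ| < 1) (y : Fin 4 → ℝ) :
    dZ4 (fun j => fderiv ℝ (movedPolar M ρ) y (Pi.single j 1)) =
      M.det ^ 2 * (1 - (ρ : ℂ) ^ 2) ^ 4 * ((1 + (ρ : ℂ) • polar y).det⁻¹) ^ 4 *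
        (-2 * Complex.I * (Real.sin (y 3) * Real.cos (y 3)) * (polar y).det ^ 2) := by
  simp only [fderiv_movedPolar M hρ]
  rw [dZ4_mul_right _ (fun j => _ * fderiv ℝ polar y (Pi.single j 1)), dZ4_mul_left,
    dZ4_fderiv_polar, Matrix.det_smul, Matrix.det_mul, Matrix.det_nonsing_inv,
    Ring.inverse_eq_inv', Fintype.card_fin]
  ring

theorem sin_mul_cos_pos {y : Fin 4 → ℝ} (hy : y ∈ polarBox) :
    0 < Real.sin (y 3) * Real.cos (y 3) := by
  have hy3 : y 3 ∈ Set.Ioo 0 (Real.pi / 2) := hy 3 (Set.mem_univ 3)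
  have hpi := Real.pi_pos
  exact mul_pos (Real.sin_pos_of_pos_of_lt_pi hy3.1 (by linarith [hy3.2]))
    (Real.cos_pos_of_mem_Ioo ⟨by linarith [hy3.1], hy3.2⟩)

theorem det_smul_unitary_ne_zero (hR : 0 < R) (hU : U ∈ Matrix.unitaryGroup (Fin 2) ℂ) :
    (R • U).det ≠ 0 := by
  have h1 : (R • U) = (R : ℂ) • U := by ext; simp
  have h2 : U * star U = 1 := Matrix.mem_unitaryGroup_iff.1 hU
  have h3 := congrArg Matrix.det h2
  rw [Matrix.det_mul, Matrix.det_one] at h3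
  rw [h1, Matrix.det_smul]
  exact mul_ne_zero (pow_ne_zero _ (by exact_mod_cast hR.ne')) (left_ne_zero_of_mul_eq_one h3)

theorem movedPolar_mem (hU : U ∈ Matrix.unitaryGroup (Fin 2) ℂ) (hρ : |ρ| < 1)
    (y : Fin 4 → ℝ) : movedPolar (R • U) ρ y ∈ U2 R :=
  ⟨U * mobius ρ (polar y),
    mul_mem hU (mobius_mem_unitaryGroup (polar_mem_unitaryGroup y) hρ), by
      simp [movedPolar]⟩

/-- The sign of `A.det` is found by computing `dZ4` of the partial derivatives twice, from the frame
and from `dZ4_fderiv_movedPolar`. The phases cancel, leaving `A.det · |det(1 + ρY)|⁴ = (1 - ρ²)⁴ sin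
y₃ cos y₃ / 2`. -/
theorem exists_frame_matrix_movedPolar (hR : 0 < R) (hU : U ∈ Matrix.unitaryGroup (Fin 2) ℂ)
    (hρ : |ρ| < 1) {y : Fin 4 → ℝ} (hy : y ∈ polarBox) :
    ∃ A : Matrix (Fin 4) (Fin 4) ℝ, 0 < A.det ∧
      ∀ j, fderiv ℝ (movedPolar (R • U) ρ) y (Pi.single j 1) =
        ∑ i, A i j • frame (movedPolar (R • U) ρ y) i := by
  have hR' : ((R : ℂ) ^ 2) ≠ 0 := pow_ne_zero _ (by exact_mod_cast hR.ne')
  have hsq : ∀ y, (movedPolar (R • U) ρ y)ᴴ * movedPolar (R • U) ρ y =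
      ((R : ℂ) ^ 2) • (1 : HC) := by
    intro y
    obtain ⟨Z, hZ, hZy⟩ := movedPolar_mem (R := R) hU hρ y
    have h1 : Zᴴ * Z = 1 := Matrix.mem_unitaryGroup_iff'.1 hZ
    rw [← hZy]
    simp only [Matrix.conjTranspose_smul, smul_mul_smul_comm, h1]
    ext
    simp [sq]
  have hM := det_smul_unitary_ne_zero hR hU
  have hQ := polar_mem_unitaryGroup y
  have hp := det_one_add_polar_ne_zero hρ y
  have hdet : (movedPolar (R • U) ρ y).det = (R • U).det * ((polar y).det *
      star (1 + (ρ : ℂ) • polar y).det * ((1 + (ρ : ℂ) • polar y).det)⁻¹) := by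
    rw [movedPolar, Matrix.det_mul, det_mobius hQ]
  have hQdet : (polar y).det ≠ 0 := by
    rw [det_polar]
    simp [Complex.exp_ne_zero]
  have hp' : star (1 + (ρ : ℂ) • polar y).det ≠ 0 := star_ne_zero.2 hp
  have hψ : (movedPolar (R • U) ρ y).det ≠ 0 := by
    rw [hdet]
    exact mul_ne_zero hM (mul_ne_zero (mul_ne_zero hQdet hp') (inv_ne_zero hp))
  obtain ⟨A, hA, hAdet⟩ := exists_frame_matrix hψ.isUnit fun j =>
    conjTranspose_inv_mul_fderiv hR' (by simp)
      ((contDiff_movedPolar (R • U) hρ).differentiable one_ne_zero) hsq y (Pi.single j 1)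
  refine ⟨A, ?_, hA⟩
  rw [dZ4_fderiv_movedPolar _ hρ, hdet] at hAdet
  have hI := Complex.I_ne_zero
  have hns : (1 + (ρ : ℂ) • polar y).det * star (1 + (ρ : ℂ) • polar y).det =
      (Complex.normSq (1 + (ρ : ℂ) • polar y).det : ℂ) := Complex.mul_conj _
  have hnpos : 0 < Complex.normSq (1 + (ρ : ℂ) • polar y).det := Complex.normSq_pos.2 hp
  have hkey : (A.det : ℂ) * (Complex.normSq (1 + (ρ : ℂ) • polar y).det : ℂ) ^ 2 =
      (1 - (ρ : ℂ) ^ 2) ^ 4 * (Real.sin (y 3) * Real.cos (y 3)) / 2 := by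
    rw [← hns]
    generalize (1 + (ρ : ℂ) • polar y).det = p at *
    generalize star p = p' at *
    generalize (R • U).det = m at *
    generalize (polar y).det = q at *
    generalize (Real.sin (y 3) : ℂ) = s at *
    generalize (Real.cos (y 3) : ℂ) = c at *
    field_simp at hAdet ⊢
    linear_combination hAdet / 2
  have hkey' : A.det * Complex.normSq (1 + (ρ : ℂ) • polar y).det ^ 2 =
      (1 - ρ ^ 2) ^ 4 * (Real.sin (y 3) * Real.cos (y 3)) / 2 := by exact_mod_cast hkey
  have hρ2 : 0 < 1 - ρ ^ 2 := by nlinarith [sq_abs ρ, abs_nonneg ρ]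
  have hpos := sin_mul_cos_pos hy
  have : 0 < A.det * Complex.normSq (1 + (ρ : ℂ) • polar y).det ^ 2 := by
    rw [hkey']
    positivity
  exact pos_of_mul_pos_left this (by positivity)

theorem mobius_injOn_unitaryGroup (hρ : |ρ| < 1) :
    Set.InjOn (mobius ρ) (Matrix.unitaryGroup (Fin 2) ℂ : Set HC) := by
  intro Y hY Z hZ h
  rw [← mobius_neg_mobius hρ (det_one_add_ne_zero hY hρ), h,
    mobius_neg_mobius hρ (det_one_add_ne_zero hZ hρ)]

theorem movedPolar_injOn (hR : 0 < R) (hU : U ∈ Matrix.unitaryGroup (Fin 2) ℂ) (hρ : |ρ| < 1) :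
    Set.InjOn (movedPolar (R • U) ρ) polarBox := by
  intro y hy z hz h
  have hM := (det_smul_unitary_ne_zero hR hU).isUnit
  have h1 := congrArg (fun Z => (R • U)⁻¹ * Z) h
  simp only [movedPolar, Matrix.nonsing_inv_mul_cancel_left _ _ hM] at h1
  exact polar_injOn hy hz (mobius_injOn_unitaryGroup hρ (polar_mem_unitaryGroup y)
    (polar_mem_unitaryGroup z) h1)

theorem exists_movedPolar_eq (hU : U ∈ Matrix.unitaryGroup (Fin 2) ℂ)
    (hρ : |ρ| < 1) {Z : HC} (hZ : Z ∈ U2 R) :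
    ∃ y : Fin 4 → ℝ, (∀ i, y i ∈ Set.Icc 0 (polarBound i)) ∧ movedPolar (R • U) ρ y = Z := by
  obtain ⟨Y, hY, rfl⟩ := hZ
  have hX : star U * Y ∈ Matrix.unitaryGroup (Fin 2) ℂ := mul_mem (Unitary.star_mem hU) hY
  have hρ' : |-ρ| < 1 := by rwa [abs_neg]
  obtain ⟨y, hy, hyX⟩ := exists_polar_eq (mobius_mem_unitaryGroup hX hρ')
  refine ⟨y, hy, ?_⟩
  have h1 : mobius ρ (mobius (-ρ) (star U * Y)) = star U * Y := by
    have := mobius_neg_mobius hρ' (det_one_add_ne_zero hX hρ')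
    rwa [neg_neg] at this
  have h2 : U * star U = 1 := Matrix.mem_unitaryGroup_iff.1 hU
  simp only [movedPolar]
  rw [hyX, h1, smul_mul_assoc, ← mul_assoc, h2, one_mul]

/-! ### Negligibility of the part of `U(2)_R` outside the coordinate box -/

theorem contDiff_insertNth (i : Fin 4) (c : ℝ) :
    ContDiff ℝ 1 fun x : Fin 3 → ℝ => (i.insertNth c x : Fin 4 → ℝ) := by
  refine contDiff_pi.2 fun k => ?_
  rcases Fin.eq_self_or_eq_succAbove i k with rfl | ⟨j, rfl⟩
  · simpa using contDiff_const
  · simpa using contDiff_apply ℝ ℝ j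

theorem dimH_range_insertNth_le (M : HC) (hρ : |ρ| < 1) (i : Fin 4) (c : ℝ) :
    dimH (Set.range fun x : Fin 3 → ℝ => movedPolar M ρ (i.insertNth c x)) ≤ 3 := by
  have := ((contDiff_movedPolar M hρ).comp (contDiff_insertNth i c)).dimH_range_le
  exact this.trans (by simp)

theorem hausdorffMeasure_borel_eq_zero_of_dimH_lt {X : Type*} [MetricSpace X] {s : Set X} {d : ℕ}
    (h : dimH s < d) :
    @Measure.hausdorffMeasure X _ (borel X) (@BorelSpace.mk X _ (borel X) rfl) (d : ℝ) s = 0 := by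
  let _ : MeasurableSpace X := borel X
  have _ : BorelSpace X := ⟨rfl⟩
  exact hausdorffMeasure_of_dimH_lt (d := (d : NNReal)) (by exact_mod_cast h)

/-- The closed box covers `U(2)_R`, so missed points come from its faces, which lie in `C¹` images
of `ℝ³`, of dimension at most `3`. -/
theorem hausdorffMeasure_compl_movedPolar (hU : U ∈ Matrix.unitaryGroup (Fin 2) ℂ)
    (hρ : |ρ| < 1) :
    @Measure.hausdorffMeasure HC _ (borel HC) (@BorelSpace.mk HC _ (borel HC) rfl) ((4 : ℕ) : ℝ)
      (U2 R \ movedPolar (R • U) ρ '' polarBox) = 0 := by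
  have hsub : U2 R \ movedPolar (R • U) ρ '' polarBox ⊆
      ⋃ i : Fin 4, ((Set.range fun x : Fin 3 → ℝ => movedPolar (R • U) ρ (i.insertNth 0 x)) ∪
        Set.range fun x : Fin 3 → ℝ => movedPolar (R • U) ρ (i.insertNth (polarBound i) x)) := by
    rintro Z ⟨hZ, hZD⟩
    obtain ⟨y, hy, rfl⟩ := exists_movedPolar_eq hU hρ hZ
    have hyD : y ∉ polarBox := fun h => hZD ⟨y, h, rfl⟩
    obtain ⟨i, hi⟩ : ∃ i, y i ∉ Set.Ioo 0 (polarBound i) := by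
      simpa only [polarBox, Set.mem_univ_pi, not_forall] using hyD
    refine Set.mem_iUnion.2 ⟨i, ?_⟩
    have hends : y i = 0 ∨ y i = polarBound i := by
      rcases (hy i).1.eq_or_lt with h | h
      · exact Or.inl h.symm
      · exact Or.inr (le_antisymm (hy i).2 (not_lt.1 fun h' => hi ⟨h, h'⟩))
    rcases hends with h | h
    · exact Or.inl ⟨i.removeNth y, congrArg (movedPolar _ _) (by rw [← h, Fin.insertNth_self_removeNth])⟩
    · exact Or.inr ⟨i.removeNth y, congrArg (movedPolar _ _) (by rw [← h, Fin.insertNth_self_removeNth])⟩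
  have hdim : dimH (U2 R \ movedPolar (R • U) ρ '' polarBox) < ((4 : ℕ) : ENNReal) := by
    refine (dimH_mono hsub).trans_lt ?_
    rw [dimH_iUnion]
    refine (iSup_le fun i => ?_ : _ ≤ (3 : ENNReal)).trans_lt (by norm_num)
    rw [dimH_union]
    exact max_le (dimH_range_insertNth_le _ hρ _ _) (dimH_range_insertNth_le _ hρ _ _)
  exact hausdorffMeasure_borel_eq_zero_of_dimH_lt hdim

theorem isOpen_polarBox : IsOpen polarBox :=
  isOpen_set_pi Set.finite_univ fun _ _ => isOpen_Ioo

theorem isPositiveParametrization_movedPolar (hR : 0 < R)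
    (hU : U ∈ Matrix.unitaryGroup (Fin 2) ℂ) (hρ : |ρ| < 1) :
    IsPositiveParametrization (U2 R) frame polarBox (movedPolar (R • U) ρ) where
  isOpen := isOpen_polarBox
  contDiffOn := (contDiff_movedPolar _ hρ).contDiffOn
  injOn := movedPolar_injOn hR hU hρ
  mapsTo := fun y _ => movedPolar_mem hU hρ y
  positive := fun _ hy => exists_frame_matrix_movedPolar hR hU hρ hy
  null_compl := hausdorffMeasure_compl_movedPolar hU hρ

end Param

/-! ### Integration -/

theorem polarBox_subset_Icc : polarBox ⊆ Set.Icc 0 polarBound :=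
  fun _ hy => ⟨fun i => (hy i (Set.mem_univ i)).1.le, fun i => (hy i (Set.mem_univ i)).2.le⟩

/-- If the average of `g` over the first angle has the form `c sin y₃ cos y₃`, integration over
the box is elementary. -/
theorem setIntegral_polarBox {g : (Fin 4 → ℝ) → ℂ} (hg : Continuous g) {c : ℂ}
    (h : ∀ x : Fin 3 → ℝ, ∫ t in Set.Ioo 0 (2 * Real.pi), g (Fin.cons t x) =
      c * (Real.sin (x 2) * Real.cos (x 2) : ℝ)) :
    ∫ y in polarBox, g y = 2 * Real.pi ^ 2 * c := by
  have hgint : IntegrableOn g polarBox :=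
    (hg.continuousOn.integrableOn_compact isCompact_Icc).mono_set polarBox_subset_Icc
  let μ : Fin 4 → Measure ℝ := fun i => volume.restrict (Set.Ioo 0 (polarBound i))
  have hres : (volume : Measure (Fin 4 → ℝ)).restrict polarBox = Measure.pi μ := by
    rw [volume_pi, polarBox, Measure.restrict_pi_pi]
  have hmp := measurePreserving_piFinSuccAbove μ 0
  have hmp' := hmp.symm
  rw [IntegrableOn, hres, ← hmp'.integrable_comp_emb (MeasurableEquiv.measurableEmbedding _)] at hgint
  rw [hres, ← hmp'.integral_comp']
  refine (integral_prod_symm _ hgint).trans ?_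
  have hcons : ∀ (t : ℝ) (x : Fin 3 → ℝ),
      (MeasurableEquiv.piFinSuccAbove (fun _ : Fin 4 => ℝ) 0).symm (t, x) = Fin.cons t x :=
    fun t x => by simp [MeasurableEquiv.piFinSuccAbove, Fin.insertNthEquiv]
  have hμ0 : μ 0 = volume.restrict (Set.Ioo 0 (2 * Real.pi)) := rfl
  simp only [Function.comp_apply, hcons, hμ0, h]
  rw [integral_const_mul]
  -- With coordinate `0` split off, `x 2` is the former `y 3`. The three integrals are `2π`, `2π`
  -- and `1/2`, with product `2π²`.
  let f : Fin 3 → ℝ → ℂ := ![fun _ => 1, fun _ => 1,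
    fun t => ((Real.sin t * Real.cos t : ℝ) : ℂ)]
  have hf : ∀ x : Fin 3 → ℝ, ((Real.sin (x 2) * Real.cos (x 2) : ℝ) : ℂ) = ∏ i, f i (x i) := by
    intro x
    simp [Fin.prod_univ_three, f]
  simp only [hf]
  rw [integral_fin_nat_prod_eq_prod, Fin.prod_univ_three]
  have hpi := Real.pi_pos
  have h0 : ∫ x, f 0 x ∂(μ ((0 : Fin 4).succAbove 0)) = 2 * Real.pi := by
    change ∫ x in Set.Ioo 0 (2 * Real.pi), (1 : ℂ) = _
    simp [hpi.le]
  have h1 : ∫ x, f 1 x ∂(μ ((0 : Fin 4).succAbove 1)) = 2 * Real.pi := by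
    change ∫ x in Set.Ioo 0 (2 * Real.pi), (1 : ℂ) = _
    simp [hpi.le]
  have h2 : ∫ x, f 2 x ∂(μ ((0 : Fin 4).succAbove 2)) = 1 / 2 := by
    change ∫ x in Set.Ioo 0 (Real.pi / 2), ((Real.sin x * Real.cos x : ℝ) : ℂ) = _
    rw [integral_complex_ofReal, ← integral_Ioc_eq_integral_Ioo,
      ← intervalIntegral.integral_of_le (by positivity), integral_sin_mul_cos₁]
    simp
  rw [h0, h1, h2]
  ring

/-! ### The mean value property and the pulled-back integrand -/

theorem setIntegral_comp_exp_mul_I {h : ℂ → ℂ}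
    (hd : DifferentiableOn ℂ h (Metric.closedBall 0 1)) :
    ∫ t in Set.Ioo 0 (2 * Real.pi), h (Complex.exp (t * Complex.I)) = 2 * Real.pi * h 0 := by
  have hc : DiffContOnCl ℂ h (Metric.ball 0 |1|) := by
    refine DifferentiableOn.diffContOnCl ?_
    rwa [abs_one, closure_ball 0 one_ne_zero]
  have := hc.circleAverage
  rw [Real.circleAverage_def] at this
  simp only [circleMap_zero, Complex.ofReal_one, one_mul] at this
  rw [intervalIntegral.integral_of_le (by positivity), integral_Ioc_eq_integral_Ioo] at this
  rw [← this, Complex.real_smul]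
  have hpi : (2 * Real.pi : ℂ) ≠ 0 := by exact_mod_cast Real.two_pi_pos.ne'
  push_cast
  rw [← mul_assoc, mul_inv_cancel₀ hpi, one_mul]

/-- The field is left general: `ℂ` serves the mean value property, `ℝ` the continuity of the
integrand in the angles. -/
theorem differentiableOn_evalPoly {𝕜 E : Type*} [NontriviallyNormedField 𝕜] [NormedAlgebra 𝕜 ℂ]
    [NormedAddCommGroup E] [NormedSpace 𝕜 E] (F : MvPolynomial (Fin 2 × Fin 2) ℂ) {f : E → HC}
    {s : Set E} (hf : ∀ i j, DifferentiableOn 𝕜 (fun x => f x i j) s) :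
    DifferentiableOn 𝕜 (fun x => evalPoly F (f x)) s := by
  induction F using MvPolynomial.induction_on with
  | C a => simp [evalPoly]
  | add p q hp hq =>
    simp only [evalPoly, map_add] at *
    exact hp.add hq
  | mul_X p n hp =>
    simp only [evalPoly, map_mul, MvPolynomial.eval_X] at *
    exact hp.mul (hf _ _)

/-- The function on the disc whose mean value property gives the reproducing formula. -/
theorem differentiableOn_evalPoly_mobius (F : MvPolynomial (Fin 2 × Fin 2) ℂ) (M : HC) {ρ : ℝ}
    (hρ : |ρ| < 1) {Q : HC} (hQ : Q ∈ Matrix.unitaryGroup (Fin 2) ℂ) :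
    DifferentiableOn ℂ (fun z : ℂ => evalPoly F (M * mobius ρ (z • Q)) *
      ((1 + (ρ : ℂ) • (z • Q)).det⁻¹) ^ 2) (Metric.closedBall 0 1) := by
  have hdet : ∀ z ∈ Metric.closedBall (0 : ℂ) 1, (1 + (ρ : ℂ) • (z • Q)).det ≠ 0 := by
    intro z hz
    rw [smul_smul]
    refine det_one_add_smul_ne_zero hQ ?_
    rw [mem_closedBall_zero_iff] at hz
    rw [norm_mul, Complex.norm_real, Real.norm_eq_abs]
    nlinarith [abs_nonneg ρ, norm_nonneg z]
  have hinv : DifferentiableOn ℂ (fun z : ℂ => (1 + (ρ : ℂ) • (z • Q)).det⁻¹)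
      (Metric.closedBall 0 1) := by
    refine DifferentiableOn.inv ?_ hdet
    simp only [Matrix.det_fin_two, Matrix.add_apply, Matrix.smul_apply, smul_eq_mul]
    fun_prop
  have hmob : ∀ i j, DifferentiableOn ℂ (fun z : ℂ => mobius ρ (z • Q) i j)
      (Metric.closedBall 0 1) := by
    intro i j
    simp only [mobius, Matrix.inv_def, Ring.inverse_eq_inv', Matrix.adjugate_fin_two,
      Matrix.mul_apply, Fin.sum_univ_two, Matrix.add_apply, Matrix.smul_apply, smul_eq_mul]
    fin_cases j <;> simp <;> fun_prop
  refine (differentiableOn_evalPoly F fun i j => ?_).mul (hinv.pow 2)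
  simp only [Matrix.mul_apply, Fin.sum_univ_two]
  have := hmob 0 j
  have := hmob 1 j
  fun_prop

/-- The Jacobian and `N(Z - W)²` share the factors `det(M)²`, `(1 - ρ²)⁴`, `det(Y)²`; of the powers
of `det(1 + ρY)`, `-4` against `-2`, the power `-2` survives. No singularity at `Y = 0` remains. -/
theorem pullbackCoeff_movedPolar (F : MvPolynomial (Fin 2 × Fin 2) ℂ) {M : HC} (hM : M.det ≠ 0)
    {ρ : ℝ} (hρ : |ρ| < 1) (y : Fin 4 → ℝ) :
    pullbackCoeff (fun Z => (evalPoly F Z / N (Z - (ρ : ℂ) • M) ^ 2) • dZ4) (movedPolar M ρ) y =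
      -2 * Complex.I * (Real.sin (y 3) * Real.cos (y 3) : ℝ) *
        (evalPoly F (M * mobius ρ (polar y)) * ((1 + (ρ : ℂ) • polar y).det⁻¹) ^ 2) := by
  have hp := det_one_add_polar_ne_zero hρ y
  have hQdet : (polar y).det ≠ 0 := by
    rw [det_polar]
    simp [Complex.exp_ne_zero]
  have hN : N (movedPolar M ρ y - (ρ : ℂ) • M) = M.det * ((1 - (ρ : ℂ) ^ 2) ^ 2 *
      ((polar y).det * (1 + (ρ : ℂ) • polar y).det⁻¹)) := by
    have : movedPolar M ρ y - (ρ : ℂ) • M =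
        M * (mobius ρ (polar y) - (ρ : ℂ) • (1 : HC)) := by
      rw [mul_sub, mul_smul_comm, mul_one, movedPolar]
    rw [N, this, Matrix.det_mul, mobius_sub hp, Matrix.det_smul, Matrix.det_mul,
      Matrix.det_nonsing_inv, Ring.inverse_eq_inv', Fintype.card_fin]
  have hc := one_sub_sq_ne_zero hρ
  change evalPoly F (M * mobius ρ (polar y)) / N (movedPolar M ρ y - (ρ : ℂ) • M) ^ 2 *
    dZ4 (fun j => fderiv ℝ (movedPolar M ρ) y (Pi.single j 1)) = _
  rw [dZ4_fderiv_movedPolar M hρ, hN]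
  push_cast
  field_simp

theorem continuous_pullback (F : MvPolynomial (Fin 2 × Fin 2) ℂ) (M : HC) {ρ : ℝ}
    (hρ : |ρ| < 1) : Continuous fun y : Fin 4 → ℝ =>
      -2 * Complex.I * (Real.sin (y 3) * Real.cos (y 3) : ℝ) *
        (evalPoly F (M * mobius ρ (polar y)) * ((1 + (ρ : ℂ) • polar y).det⁻¹) ^ 2) := by
  have h1 : Continuous fun y => evalPoly F (M * mobius ρ (polar y)) := by
    refine continuousOn_univ.1 (DifferentiableOn.continuousOn (𝕜 := ℝ) ?_)
    refine differentiableOn_evalPoly F fun i j => ?_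
    exact ((contDiff_matrix_iff.1 (contDiff_movedPolar M hρ) i j).differentiable
      one_ne_zero).differentiableOn
  have h2 : Continuous fun y => (1 + (ρ : ℂ) • polar y).det⁻¹ := by
    refine Continuous.inv₀ ?_ (det_one_add_polar_ne_zero hρ)
    have := contDiff_polar.continuous
    exact Continuous.matrix_det (by fun_prop)
  fun_prop

theorem mobius_zero_right (ρ : ℝ) : mobius ρ 0 = (ρ : ℂ) • (1 : HC) := by
  simp [mobius]

theorem hasFormIntegral_U2 (F : MvPolynomial (Fin 2 × Fin 2) ℂ) {R ρ : ℝ} (hR : 0 < R)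
    (hρ : |ρ| < 1) {U : HC} (hU : U ∈ Matrix.unitaryGroup (Fin 2) ℂ) :
    HasFormIntegral (U2 R) frame
      (fun Z => (evalPoly F Z / N (Z - (ρ : ℂ) • (R • U)) ^ 2) • dZ4)
      (-8 * Complex.I * (Real.pi : ℂ) ^ 3 * evalPoly F ((ρ : ℂ) • (R • U))) := by
  have hpull := funext (pullbackCoeff_movedPolar F (det_smul_unitary_ne_zero hR hU) hρ)
  have hcont := continuous_pullback F (R • U) hρ
  refine ⟨polarBox, movedPolar (R • U) ρ, isPositiveParametrization_movedPolar hR hU hρ, ?_, ?_⟩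
  · rw [hpull]
    exact (hcont.continuousOn.integrableOn_compact isCompact_Icc).mono_set polarBox_subset_Icc
  rw [hpull, setIntegral_polarBox hcont
    -- `-2i` from the polar Jacobian times `2π` from the mean value property.
    (c := -4 * Complex.I * Real.pi * evalPoly F ((ρ : ℂ) • (R • U)))]
  · ring
  intro x
  -- `angularPart` does not involve coordinate `0`, so varying `t` traces the boundary circle of the
  -- disc `z ↦ z • Q` with `Q` fixed.
  have hpolar : ∀ t : ℝ, polar (Fin.cons t x) =
      Complex.exp (t * Complex.I) • angularPart (Fin.cons 0 x) := fun t => rfl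
  have h3 : ∀ t : ℝ, (Fin.cons t x : Fin 4 → ℝ) 3 = x 2 := fun t => rfl
  simp only [hpolar, h3]
  rw [integral_const_mul, setIntegral_comp_exp_mul_I
    (differentiableOn_evalPoly_mobius F (R • U) hρ (angularPart_mem_unitaryGroup _))]
  simp only [zero_smul, smul_zero, add_zero, Matrix.det_one, inv_one, one_pow, mul_one,
    mobius_zero_right, mul_smul_comm]
  ring

/-- Every real quaternion of norm less than `R` is a multiple, with factor in `[0, 1)`, of an
element of `U(2)_R`. -/
theorem exists_ofQuaternion_eq {R : ℝ} (hR : 0 < R) {W : ℍ[ℝ]}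
    (hW : Quaternion.normSq W < R ^ 2) :
    ∃ (ρ : ℝ) (U : HC), |ρ| < 1 ∧ U ∈ Matrix.unitaryGroup (Fin 2) ℂ ∧
      ofQuaternion W = (ρ : ℂ) • (R • U) := by
  -- The origin has no direction to normalize; with `ρ = 0` any unitary matrix serves.
  by_cases h0 : W = 0
  · refine ⟨0, 1, by simp, one_mem _, ?_⟩
    simp [h0, ofQuaternion]
  have hn : 0 < ‖W‖ := norm_pos_iff.2 h0
  have hnn : Quaternion.normSq W = ‖W‖ ^ 2 := by rw [Quaternion.normSq_eq_norm_mul_self, sq]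
  have hlt : ‖W‖ < R := lt_of_pow_lt_pow_left₀ 2 hR.le (hnn ▸ hW)
  have hstar : ofQuaternion W * (ofQuaternion W)ᴴ = ((‖W‖ : ℂ) ^ 2) • (1 : HC) := by
    have h : ((‖W‖ : ℂ) ^ 2) = (Quaternion.normSq W : ℝ) := by rw [hnn]; simp
    rw [h, Quaternion.normSq_def', ofQuaternion]
    generalize W.re = a
    generalize W.imI = b
    generalize W.imJ = c
    generalize W.imK = d
    ext i j
    fin_cases i <;> fin_cases j <;>
      simp [basisM, Matrix.mul_apply, Fin.sum_univ_two, Complex.ext_iff, sq] <;>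
      constructor <;> ring
  -- By `hstar`, a nonzero real quaternion divided by its norm is unitary.
  refine ⟨‖W‖ / R, (‖W‖ : ℂ)⁻¹ • ofQuaternion W, ?_, ?_, ?_⟩
  · rw [abs_of_nonneg (by positivity), div_lt_one hR]
    exact hlt
  · have hn' : (‖W‖ : ℂ) ≠ 0 := by exact_mod_cast hn.ne'
    rw [Matrix.mem_unitaryGroup_iff, Matrix.star_eq_conjTranspose, Matrix.conjTranspose_smul,
      smul_mul_smul_comm, hstar, smul_smul]
    have : (‖W‖ : ℂ)⁻¹ * star (‖W‖ : ℂ)⁻¹ * (‖W‖ : ℂ) ^ 2 = 1 := by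
      simp
      field_simp
    rw [this, one_smul]
  · have hn' : (‖W‖ : ℂ) ≠ 0 := by exact_mod_cast hn.ne'
    have hR' : (R : ℂ) ≠ 0 := by exact_mod_cast hR.ne'
    ext i j
    simp only [Matrix.smul_apply, Complex.real_smul, smul_eq_mul]
    push_cast
    field_simp

end HC

theorem mainTheorem2 (F : MvPolynomial (Fin 2 × Fin 2) ℂ) (R : ℝ) (hR : 0 < R)
    (W : ℍ[ℝ]) (hW : Quaternion.normSq W < R ^ 2) :
    ∃ I : ℂ,
      HasFormIntegral (HC.U2 R) HC.frame
        (fun Z => (HC.evalPoly F Z / HC.N (Z - HC.ofQuaternion W) ^ 2) • HC.dZ4) I ∧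
      HC.evalPoly F (HC.ofQuaternion W) = Complex.I / (8 * (Real.pi : ℂ) ^ 3) * I := by
  obtain ⟨ρ, U, hρ, hU, hWU⟩ := HC.exists_ofQuaternion_eq hR hW
  rw [hWU]
  refine ⟨_, HC.hasFormIntegral_U2 F hR hρ hU, ?_⟩
  have hpi : (Real.pi : ℂ) ≠ 0 := by exact_mod_cast Real.pi_ne_zero
  field_simp
  rw [Complex.I_sq]
  ring
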